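/- All graphs are simple, undirected, connected and locally finite (possibly infinite); $d(\cdot,\cdot)$ denotes the combinatorial distance. For a regular graph of degree $d\ge 1$, a vertex $x$ and $p\in[0,1]$, let $\mu_x^p$ be the probability measure with mass $p$ at $x$ and mass $\frac{1-p}{d}$ at each neighbour of $x$. Let $$W_1(\mu_1,\mu_2)=\inf_\pi\sum_{u,v}d(u,v)\,\pi(u,v),$$ where $\pi\ge 0$ runs over all transport plans with marginals $\mu_1,\mu_2$. For an edge $\{x,y\}$ put $$\kappa_p(x,y)=1-W_1(\mu_x^p,\mu_y^p),\qquad \kappa_{LLY}(x,y)=\lim_{p\to 1^-}\frac{\kappa_p(x,y)}{1-p}.$$ The strong product $G\boxtimes H$ has vertex set $V_G\times V_H$, and its edges are the horizontal edges $\{(x_1,y),(x_2,y)\}$ with $x_1\sim x_2$ in $G$, the vertical edges $\{(x,y_1),(x,y_2)\}$ with $y_1\sim y_2$ in $H$, and the diagonal edges $\{(x_1,y_1),(x_2,y_2)\}$ with $x_1\sim x_2$ in $G$ and $y_1\sim y_2$ in $H$. **Theorem.** Let $G$ and $H$ be regular graphs of vertex degrees $d_G$ and $d_H$. Then $G\boxtimes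 H$ is regular of degree $d_{G\boxtimes H}=d_G+d_H+d_Gd_H$. Let $\kappa_*$ be either $\kappa_0$ or $\kappa_{LLY}$; the limits defining $\kappa_{LLY}$ on the edges below exist. For every edge $x_1\sim x_2$ of $G$ and every vertex $y_1$ of $H$, $$\kappa_*^{G\boxtimes H}\big((x_1,y_1),(x_2,y_1)\big)\ \ge\ \frac{d_G(d_H+1)}{d_{G\boxtimes H}}\,\kappa_*^{G}(x_1,x_2),$$ and for every vertex $x_1$ of $G$ and every edge $y_1\sim y_2$ of $H$, $$\kappa_*^{G\boxtimes H}\big((x_1,y_1),(x_1,y_2)\big)\ \ge\ \frac{d_H(d_G+1)}{d_{G\boxtimes H}}\,\kappa_*^{H}(y_1,y_2).$$ -/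

import Mathlib

open Filter Topology

namespace SimpleGraph

/-- The strong product `G ⊠ H`: its edges are the horizontal edges `{(x₁, y), (x₂, y)}` with
`x₁ ∼ x₂`, the vertical edges `{(x, y₁), (x, y₂)}` with `y₁ ∼ y₂`, and the diagonal edges
`{(x₁, y₁), (x₂, y₂)}` with `x₁ ∼ x₂` and `y₁ ∼ y₂`. -/
def strongProd {V W : Type*} (G : SimpleGraph V) (H : SimpleGraph W) : SimpleGraph (V × W) where
  Adj a b := (G.Adj a.1 b.1 ∧ a.2 = b.2) ∨ (a.1 = b.1 ∧ H.Adj a.2 b.2) ∨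
    (G.Adj a.1 b.1 ∧ H.Adj a.2 b.2)
  symm.symm a b := by simp [eq_comm, adj_comm]
  loopless.irrefl a := by simp

noncomputable instance strongProdLocallyFinite {V W : Type*} (G : SimpleGraph V)
    (H : SimpleGraph W) [G.LocallyFinite] [H.LocallyFinite] :
    (G.strongProd H).LocallyFinite := fun a =>
  Set.Finite.fintype <| by
    refine Set.Finite.subset (((Set.toFinite (G.neighborSet a.1)).insert a.1).prod
      ((Set.toFinite (H.neighborSet a.2)).insert a.2)) ?_
    rintro ⟨u, v⟩ h
    rcases h with ⟨h1, h2⟩ | ⟨h1, h2⟩ | ⟨h1, h2⟩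
    · exact ⟨Or.inr h1, Or.inl h2.symm⟩
    · exact ⟨Or.inl h1.symm, Or.inr h2⟩
    · exact ⟨Or.inr h1, Or.inr h2⟩

open Classical in
/-- The mass function of the lazy random walk measure `μ_x^p` with idleness `p`: mass `p` at `x`
and mass `(1 - p) / d_x` at each neighbour of `x`. -/
noncomputable def idleMeasure {V : Type*} (G : SimpleGraph V) [G.LocallyFinite]
    (p : ℝ) (x : V) : V → ℝ := fun z =>
  if z = x then p else if G.Adj x z then (1 - p) / (G.degree x : ℝ) else 0

/-- `π` is a transport plan from the mass function `μ₁` to the mass function `μ₂`. -/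
structure IsTransportPlan {V : Type*} (μ₁ μ₂ : V → ℝ) (π : V → V → ℝ) : Prop where
  nonneg : ∀ x y, 0 ≤ π x y
  fst_marginal : ∀ x, HasSum (fun y => π x y) (μ₁ x)
  snd_marginal : ∀ y, HasSum (fun x => π x y) (μ₂ y)

/-- The cost of a transport plan for the combinatorial distance of `G`, as an extended
nonnegative real. -/
noncomputable def transportCost {V : Type*} (G : SimpleGraph V) (π : V → V → ℝ) : ENNReal :=
  ∑' y, ∑' x, (G.dist x y : ENNReal) * ENNReal.ofReal (π x y)

/-- The Wasserstein distance `W₁`: the infimum of the costs of all transport plans. -/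
noncomputable def wasserstein {V : Type*} (G : SimpleGraph V) (μ₁ μ₂ : V → ℝ) : ENNReal :=
  ⨅ (π : V → V → ℝ) (_ : IsTransportPlan μ₁ μ₂ π), G.transportCost π

/-- The `p`-Ollivier Ricci curvature `κ_p(x, y) = 1 - W₁(μ_x^p, μ_y^p)`. For vertices of positive
degree and `p ∈ [0, 1]` both measures are finitely supported probability measures, so that `W₁` is
a finite number. -/
noncomputable def ollivierCurvature {V : Type*} (G : SimpleGraph V) [G.LocallyFinite]
    (p : ℝ) (x y : V) : ℝ :=
  1 - (G.wasserstein (G.idleMeasure p x) (G.idleMeasure p y)).toReal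

/-- The Lin–Lu–Yau curvature `κ_LLY(x, y) = lim_{p → 1} κ_p(x, y) / (1 - p)`, where `p` runs
through idleness parameters below `1`. -/
noncomputable def llyCurvature {V : Type*} (G : SimpleGraph V) [G.LocallyFinite] (x y : V) : ℝ :=
  limUnder (𝓝[<] (1 : ℝ)) fun p => G.ollivierCurvature p x y / (1 - p)

/-- The limit defining `κ_LLY(x, y)` exists as a real number (and it is then `llyCurvature`). -/
def LLYCurvatureExists {V : Type*} (G : SimpleGraph V) [G.LocallyFinite] (x y : V) : Prop :=
  Tendsto (fun p => G.ollivierCurvature p x y / (1 - p)) (𝓝[<] (1 : ℝ)) (𝓝 (G.llyCurvature x y))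

end SimpleGraph

namespace SimpleGraph

/-! Both inequalities come from product measures: a plan on `G` can be run in every horizontal layer
of the strong product, and its cost is only multiplied by the mass of the vertical factor
(`Connected.wasserstein_strongProd_le`).

For `κ₀`, put `D = dG + dH + dG * dH`. The uniform measure on the neighbours of `(x, y)` splits into
`μ_x^0` times `dG / D` on the closed ball at `y`, and the point mass at `x` times `1 / D` on the
neighbours of `y`. Moving both parts horizontally costs at most `dG (dH + 1) / D * W₁ + dH / D`, and
the two coefficients sum to `1`.

For `κ_LLY`, the limit is replaced by a single idleness: `κ_LLY = (d + 1) / d * κ_{1/(d+1)}`, where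
`μ_x^{1/(d+1)}` is uniform on the closed ball. Closed balls of the strong product are products of
closed balls, so no second term appears, and `D + 1 = (dG + 1) (dH + 1)` gives the constant.

The replacement rests on `κ_p` being linear in `1 - p` for `1/(d+1) ≤ p < 1`. There `μ_x^p` is a
multiple of the ball indicator plus nonnegative excess mass at `x`, and moving the excess straight
from `x` to `y` is optimal. This is proved on plans, without duality: `exists_plan_of_exchange`
reroutes a given plan at no extra cost.

Vertical edges follow by swapping the factors. -/

theorem _root_.HasSum.of_eq {ι : Type*} {f g : ι → ℝ} {a b : ℝ} (h : HasSum g b)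
    (hf : ∀ i, f i = g i) (hab : a = b) : HasSum f a := by
  rwa [funext hf, hab]

/-! ### Wasserstein distance: convexity and exchange of mass -/

section Wasserstein

variable {V : Type*} (G : SimpleGraph V)

theorem transportCost_add {π ρ : V → V → ℝ} (hπ : ∀ x y, 0 ≤ π x y) (hρ : ∀ x y, 0 ≤ ρ x y) :
    G.transportCost (π + ρ) = G.transportCost π + G.transportCost ρ := by
  simp only [transportCost, ← ENNReal.tsum_add, ← mul_add, Pi.add_apply]
  refine tsum_congr fun y => tsum_congr fun x => ?_
  rw [ENNReal.ofReal_add (hπ x y) (hρ x y)]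

theorem transportCost_smul (c : ℝ) (hc : 0 ≤ c) (π : V → V → ℝ) :
    G.transportCost (c • π) = ENNReal.ofReal c * G.transportCost π := by
  simp only [transportCost, ← ENNReal.tsum_mul_left, Pi.smul_apply, smul_eq_mul]
  refine tsum_congr fun y => tsum_congr fun x => ?_
  rw [ENNReal.ofReal_mul hc]
  ring

theorem IsTransportPlan.add {μ₁ μ₂ ν₁ ν₂ : V → ℝ} {π ρ : V → V → ℝ}
    (hπ : IsTransportPlan μ₁ μ₂ π) (hρ : IsTransportPlan ν₁ ν₂ ρ) :
    IsTransportPlan (μ₁ + ν₁) (μ₂ + ν₂) (π + ρ) where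
  nonneg x y := add_nonneg (hπ.nonneg x y) (hρ.nonneg x y)
  fst_marginal x := (hπ.fst_marginal x).add (hρ.fst_marginal x)
  snd_marginal y := (hπ.snd_marginal y).add (hρ.snd_marginal y)

theorem IsTransportPlan.smul {μ ν : V → ℝ} {π : V → V → ℝ} (hπ : IsTransportPlan μ ν π)
    {c : ℝ} (hc : 0 ≤ c) : IsTransportPlan (c • μ) (c • ν) (c • π) where
  nonneg x y := mul_nonneg hc (hπ.nonneg x y)
  fst_marginal x := (hπ.fst_marginal x).mul_left c
  snd_marginal y := (hπ.snd_marginal y).mul_left c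

variable {G} in
theorem wasserstein_le {μ ν : V → ℝ} {π : V → V → ℝ} (hπ : IsTransportPlan μ ν π) :
    G.wasserstein μ ν ≤ G.transportCost π :=
  iInf₂_le π hπ

theorem wasserstein_add_le (μ₁ μ₂ ν₁ ν₂ : V → ℝ) :
    G.wasserstein (μ₁ + ν₁) (μ₂ + ν₂) ≤ G.wasserstein μ₁ μ₂ + G.wasserstein ν₁ ν₂ := by
  simp only [wasserstein, ENNReal.iInf_add, ENNReal.add_iInf]
  refine le_iInf₂ fun ρ hρ => le_iInf₂ fun π hπ => ?_
  rw [← G.transportCost_add hπ.nonneg hρ.nonneg]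
  exact wasserstein_le (hπ.add hρ)

theorem wasserstein_smul_le (μ ν : V → ℝ) {c : ℝ} (hc : 0 < c) :
    G.wasserstein (c • μ) (c • ν) ≤ ENNReal.ofReal c * G.wasserstein μ ν := by
  have h0 : ENNReal.ofReal c ≠ 0 := by simpa using hc
  conv_rhs => rw [wasserstein, ENNReal.mul_iInf_of_ne h0 ENNReal.ofReal_ne_top]
  refine le_iInf fun π => ?_
  rw [ENNReal.mul_iInf_of_ne h0 ENNReal.ofReal_ne_top]
  refine le_iInf fun hπ => ?_
  rw [← G.transportCost_smul c hc.le]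
  exact wasserstein_le (hπ.smul hc.le)

theorem wasserstein_smul (μ ν : V → ℝ) {c : ℝ} (hc : 0 < c) :
    G.wasserstein (c • μ) (c • ν) = ENNReal.ofReal c * G.wasserstein μ ν := by
  refine (G.wasserstein_smul_le μ ν hc).antisymm ?_
  have h := G.wasserstein_smul_le (c • μ) (c • ν) (inv_pos.2 hc)
  rw [inv_smul_smul₀ hc.ne', inv_smul_smul₀ hc.ne'] at h
  calc _ ≤ ENNReal.ofReal c * (ENNReal.ofReal c⁻¹ * G.wasserstein (c • μ) (c • ν)) := by gcongr
    _ = _ := by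
      rw [← mul_assoc, ← ENNReal.ofReal_mul hc.le, mul_inv_cancel₀ hc.ne']
      simp

theorem wasserstein_self {μ : V → ℝ} (hμ : ∀ x, 0 ≤ μ x) : G.wasserstein μ μ = 0 := by
  classical
  have hp : IsTransportPlan μ μ (fun x y => if y = x then μ x else 0) :=
    { nonneg := fun x y => by split_ifs <;> simp [hμ]
      fst_marginal := fun x => hasSum_ite_eq x (μ x)
      snd_marginal := fun y => by
        convert hasSum_ite_eq y (μ y) using 2 with x
        by_cases h : x = y
        · simp [h]
        · simp [h, Ne.symm h] }
  refine le_antisymm ((wasserstein_le hp).trans ?_) zero_le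
  refine le_of_eq (ENNReal.tsum_eq_zero.2 fun y => ENNReal.tsum_eq_zero.2 fun x => ?_)
  by_cases h : y = x <;> simp [h]

open Classical in
theorem wasserstein_single_le (x y : V) {s : ℝ} (hs : 0 ≤ s) :
    G.wasserstein (Pi.single x s) (Pi.single y s) ≤ ENNReal.ofReal s * G.dist x y := by
  have hp : IsTransportPlan (Pi.single x s) (Pi.single y s)
      (fun u v => if u = x then (if v = y then s else 0) else 0) :=
    { nonneg := fun u v => by split_ifs <;> simp [hs]
      fst_marginal := fun u => by
        by_cases h : u = x
        · subst h; simp [hasSum_ite_eq]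
        · simp [h, hasSum_zero]
      snd_marginal := fun v => by
        by_cases h : v = y
        · subst h; simp [hasSum_ite_eq]
        · simp [h, hasSum_zero] }
  refine (wasserstein_le hp).trans (le_of_eq ?_)
  rw [transportCost, tsum_eq_single y, tsum_eq_single x]
  · simp [mul_comm]
  · intro u hu; simp [hu]
  · intro v hv; simp [hv]

/-- The product plan has finite cost. This justifies passing to `toReal`, which would turn an
infinite distance into `0`. -/
theorem wasserstein_ne_top {μ ν : V → ℝ} (hμ : ∀ x, 0 ≤ μ x) (hν : ∀ x, 0 ≤ ν x)
    (hμs : HasSum μ 1) (hνs : HasSum ν 1) (hμf : (Function.support μ).Finite)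
    (hνf : (Function.support ν).Finite) : G.wasserstein μ ν ≠ ⊤ := by
  have hp : IsTransportPlan μ ν (fun u v => μ u * ν v) :=
    { nonneg := fun u v => mul_nonneg (hμ u) (hν v)
      fst_marginal := fun u => by simpa using hνs.mul_left (μ u)
      snd_marginal := fun v => by simpa using hμs.mul_right (ν v) }
  refine ((wasserstein_le hp).trans_lt ?_).ne
  rw [transportCost, tsum_eq_sum (s := hνf.toFinset)]
  · refine ENNReal.sum_lt_top.2 fun v _ => ?_
    rw [tsum_eq_sum (s := hμf.toFinset)]
    · exact ENNReal.sum_lt_top.2 fun u _ =>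
        ENNReal.mul_lt_top (ENNReal.natCast_lt_top _) ENNReal.ofReal_lt_top
    · intro u hu
      simp_all
  · intro v hv
    simp_all

/-- Exchanging mass: when sending `u` to `v` and `a` to `b` is never more expensive than sending
`u` to `b` and `a` to `v`, additional mass from `a` to `b` may be transported directly. -/
theorem exists_plan_of_exchange {μ ν : V → ℝ} (hμ : ∀ x, 0 ≤ μ x) (hν : ∀ x, 0 ≤ ν x) {s : ℝ}
    (hs : 0 < s) {a b : V} {f g : V → ℝ} (hfa : f a = μ a + s) (hf : ∀ u, u ≠ a → f u = μ u)
    (hgb : g b = ν b + s) (hg : ∀ v, v ≠ b → g v = ν v)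
    (hex : ∀ u v, μ u ≠ 0 → ν v ≠ 0 → G.dist u v + G.dist a b ≤ G.dist u b + G.dist a v)
    {π : V → V → ℝ} (hπ : IsTransportPlan f g π) (hab : π a b = 0) :
    ∃ ρ, IsTransportPlan μ ν ρ ∧
      G.transportCost ρ + ENNReal.ofReal s * G.dist a b ≤ G.transportCost π := by
  classical
  -- `α` and `β` are the fractions of row `a` and of column `b` that have to be rerouted so that
  -- mass `s` is removed from each.
  set α : ℝ := s / f a with hα
  set β : ℝ := s / g b with hβ
  set k : ℝ := α * β / s with hk
  have hfa0 : 0 < f a := by have := hμ a; linarith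
  have hgb0 : 0 < g b := by have := hν b; linarith
  have hα0 : 0 ≤ α := by positivity
  have hβ0 : 0 ≤ β := by positivity
  have hk0 : 0 ≤ k := by positivity
  have hα1 : α ≤ 1 := (div_le_one hfa0).2 (by have := hμ a; linarith)
  have hβ1 : β ≤ 1 := (div_le_one hgb0).2 (by have := hν b; linarith)
  have hαf : α * f a = s := div_mul_cancel₀ _ hfa0.ne'
  have hβg : β * g b = s := div_mul_cancel₀ _ hgb0.ne'
  have hkf : k * f a = β := by
    rw [hk]; field_simp; linear_combination β * hαf
  have hkg : k * g b = α := by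
    rw [hk]; field_simp; linear_combination α * hβg
  have hn := hπ.nonneg
  let A : V → ℝ := fun u => if u = a then 1 - α else 1
  let B : V → ℝ := fun v => if v = b then 1 - β else 1
  have hA : ∀ u, 0 ≤ A u := fun u => by simp only [A]; split_ifs <;> linarith
  have hB : ∀ v, 0 ≤ B v := fun v => by simp only [B]; split_ifs <;> linarith
  -- `σ` keeps what is not rerouted. `τ` sends the mass that `u` sent to `b` on to the targets `v`
  -- of `a`, proportionally to `π a v`. The factor `k` makes the total mass of `τ` equal to `s` and
  -- restores the other marginals.
  let σ : V → V → ℝ := fun u v => π u v * (A u * B v)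
  let τ : V → V → ℝ := fun u v => k * (π u b * π a v)
  have hσ : ∀ u v, 0 ≤ σ u v := fun u v => mul_nonneg (hn u v) (mul_nonneg (hA u) (hB v))
  have hτ : ∀ u v, 0 ≤ τ u v := fun u v => mul_nonneg hk0 (mul_nonneg (hn _ _) (hn _ _))
  have hπf : ∀ u v, f u = 0 → π u v = 0 := fun u v h =>
    congrFun ((hasSum_zero_iff_of_nonneg (hn u)).1 (h ▸ hπ.fst_marginal u)) v
  have hπg : ∀ u v, g v = 0 → π u v = 0 := fun u v h =>
    congrFun ((hasSum_zero_iff_of_nonneg fun u => hn u v).1 (h ▸ hπ.snd_marginal v)) u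
  refine ⟨σ + τ, ⟨fun u v => add_nonneg (hσ u v) (hτ u v), fun u => ?_, fun v => ?_⟩, ?_⟩
  · have h1 := ((hπ.fst_marginal u).sub (hasSum_ite_eq b (β * π u b))).mul_left (A u)
    have h2 := ((hπ.fst_marginal a).mul_left (π u b)).mul_left k
    refine (h1.add h2).of_eq (fun w => ?_) ?_
    · by_cases hv : w = b
      · subst hv; simp [σ, τ, B]; ring
      · simp [σ, τ, B, hv]; ring
    · by_cases hu : u = a
      · subst hu; simp [A, hab]; linear_combination -hfa + hαf
      · simp [A, hu, ← hf u hu]; linear_combination -π u b * hkf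
  · have h1 := ((hπ.snd_marginal v).sub (hasSum_ite_eq a (α * π a v))).mul_left (B v)
    have h2 := ((hπ.snd_marginal b).mul_left (π a v)).mul_left k
    refine (h1.add h2).of_eq (fun w => ?_) ?_
    · by_cases hu : w = a
      · subst hu; simp [σ, τ, A]; ring
      · simp [σ, τ, A, hu]; ring
    · by_cases hv : v = b
      · subst hv; simp [B, hab]; linear_combination -hgb + hβg
      · simp [B, hv, ← hg v hv]; linear_combination -π a v * hkg
  rw [G.transportCost_add hσ hτ]
  have e1 : ∑' u, ENNReal.ofReal (π u b) = ENNReal.ofReal (g b) := by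
    rw [← (hπ.snd_marginal b).tsum_eq,
      ENNReal.ofReal_tsum_of_nonneg (fun u => hn u b) (hπ.snd_marginal b).summable]
  have e2 : ∑' v, ENNReal.ofReal (π a v) = ENNReal.ofReal (f a) := by
    rw [← (hπ.fst_marginal a).tsum_eq,
      ENNReal.ofReal_tsum_of_nonneg (hn a) (hπ.fst_marginal a).summable]
  -- This is the exchange inequality integrated against `k * π u b * π a v`, a measure of mass `s`
  -- on pairs `(u, v)`.
  have key : G.transportCost τ + ENNReal.ofReal s * G.dist a b ≤
      ENNReal.ofReal β * ∑' u, (G.dist u b : ENNReal) * ENNReal.ofReal (π u b) +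
      ENNReal.ofReal α * ∑' v, (G.dist a v : ENNReal) * ENNReal.ofReal (π a v) := by
    have hs' : ENNReal.ofReal s = ENNReal.ofReal k * (∑' u, ENNReal.ofReal (π u b)) *
        ∑' v, ENNReal.ofReal (π a v) := by
      rw [e1, e2, ← ENNReal.ofReal_mul hk0, ← ENNReal.ofReal_mul (by positivity), hkg, hαf]
    have hb' : ENNReal.ofReal β = ENNReal.ofReal k * ∑' v, ENNReal.ofReal (π a v) := by
      rw [e2, ← ENNReal.ofReal_mul hk0, hkf]
    have ha' : ENNReal.ofReal α = ENNReal.ofReal k * ∑' u, ENNReal.ofReal (π u b) := by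
      rw [e1, ← ENNReal.ofReal_mul hk0, hkg]
    have r1 : ENNReal.ofReal s * G.dist a b = ∑' v, ∑' u, (G.dist a b : ENNReal) *
        (ENNReal.ofReal k * (ENNReal.ofReal (π u b) * ENNReal.ofReal (π a v))) := by
      simp only [ENNReal.tsum_mul_left, ENNReal.tsum_mul_right, hs']
      ring
    have r2 : ENNReal.ofReal β * ∑' u, (G.dist u b : ENNReal) * ENNReal.ofReal (π u b) =
        ∑' v, ∑' u, (G.dist u b : ENNReal) *
        (ENNReal.ofReal k * (ENNReal.ofReal (π u b) * ENNReal.ofReal (π a v))) := by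
      rw [hb']
      have : ∀ u v, (G.dist u b : ENNReal) *
        (ENNReal.ofReal k * (ENNReal.ofReal (π u b) * ENNReal.ofReal (π a v))) =
        ENNReal.ofReal k * ENNReal.ofReal (π a v) *
          ((G.dist u b : ENNReal) * ENNReal.ofReal (π u b)) := fun u v => by ring
      simp only [this, ENNReal.tsum_mul_left, ENNReal.tsum_mul_right]
    have r3 : ENNReal.ofReal α * ∑' v, (G.dist a v : ENNReal) * ENNReal.ofReal (π a v) =
        ∑' v, ∑' u, (G.dist a v : ENNReal) *
        (ENNReal.ofReal k * (ENNReal.ofReal (π u b) * ENNReal.ofReal (π a v))) := by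
      rw [ha']
      have : ∀ u v, (G.dist a v : ENNReal) *
        (ENNReal.ofReal k * (ENNReal.ofReal (π u b) * ENNReal.ofReal (π a v))) =
        ENNReal.ofReal k * ((G.dist a v : ENNReal) * ENNReal.ofReal (π a v)) *
          ENNReal.ofReal (π u b) := fun u v => by ring
      simp only [this, ENNReal.tsum_mul_left, ENNReal.tsum_mul_right]
      ring
    rw [r1, r2, r3, transportCost, ← ENNReal.tsum_add, ← ENNReal.tsum_add]
    refine ENNReal.tsum_le_tsum fun v => ?_
    rw [← ENNReal.tsum_add, ← ENNReal.tsum_add]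
    refine ENNReal.tsum_le_tsum fun u => ?_
    simp only [τ]
    rw [ENNReal.ofReal_mul hk0, ENNReal.ofReal_mul (hn u b), ← add_mul, ← add_mul]
    by_cases h0 : π u b * π a v = 0
    · rw [← ENNReal.ofReal_mul (hn u b), h0]; simp
    have hd : G.dist u v + G.dist a b ≤ G.dist u b + G.dist a v := by
      -- The inequality is trivial for `u = a` or `v = b`. Otherwise `f u = μ u` and `g v = ν v`, so
      -- the pairs that matter lie in the supports of `μ` and `ν`.
      by_cases hu : u = a
      · subst hu; omega
      by_cases hv : v = b
      · subst hv; omega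
      refine hex u v (fun h => h0 ?_) (fun h => h0 ?_)
      · rw [hπf u b (by rw [hf u hu, h]), zero_mul]
      · rw [hπg a v (by rw [hg v hv, h]), mul_zero]
    exact mul_le_mul_left (by exact_mod_cast hd) _
  -- The removed row and column meet only at `(a, b)`, where `π` vanishes, so nothing is subtracted
  -- twice.
  have key2 : G.transportCost σ +
      (ENNReal.ofReal β * ∑' u, (G.dist u b : ENNReal) * ENNReal.ofReal (π u b) +
      ENNReal.ofReal α * ∑' v, (G.dist a v : ENNReal) * ENNReal.ofReal (π a v)) ≤
      G.transportCost π := by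
    have r2 : ENNReal.ofReal β * ∑' u, (G.dist u b : ENNReal) * ENNReal.ofReal (π u b) =
        ∑' v, ∑' u, if v = b then
          ENNReal.ofReal β * ((G.dist u v : ENNReal) * ENNReal.ofReal (π u v)) else 0 := by
      rw [ENNReal.tsum_comm]
      simp [ENNReal.tsum_mul_left, tsum_ite_eq]
    have r3 : ENNReal.ofReal α * ∑' v, (G.dist a v : ENNReal) * ENNReal.ofReal (π a v) =
        ∑' v, ∑' u, if u = a then
          ENNReal.ofReal α * ((G.dist u v : ENNReal) * ENNReal.ofReal (π u v)) else 0 := by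
      simp [ENNReal.tsum_mul_left, tsum_ite_eq]
    rw [r2, r3, transportCost, transportCost, ← ENNReal.tsum_add, ← ENNReal.tsum_add]
    refine ENNReal.tsum_le_tsum fun v => ?_
    rw [← ENNReal.tsum_add, ← ENNReal.tsum_add]
    refine ENNReal.tsum_le_tsum fun u => ?_
    have aux : ∀ t : ℝ, 0 ≤ t → t ≤ 1 → ENNReal.ofReal (1 - t) + ENNReal.ofReal t = 1 := by
      intro t h0 h1
      rw [← ENNReal.ofReal_add (by linarith) h0]; simp
    have hσ' : ENNReal.ofReal (σ u v) =
        ENNReal.ofReal (π u v) * (ENNReal.ofReal (A u) * ENNReal.ofReal (B v)) := by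
      simp only [σ]
      rw [ENNReal.ofReal_mul (hn u v), ENNReal.ofReal_mul (hA u)]
    rw [hσ']
    by_cases hu : u = a <;> by_cases hv : v = b
    · subst hu hv; simp [hab]
    · simp only [hu, hv, if_true, if_false, A, B]
      simp only [ENNReal.ofReal_one, mul_one, zero_add]
      conv_rhs => rw [← mul_one (_ * _), ← aux α hα0 hα1]
      exact le_of_eq (by ring)
    · simp only [hu, hv, if_true, if_false, A, B]
      simp only [ENNReal.ofReal_one, one_mul, add_zero]
      conv_rhs => rw [← mul_one (_ * _), ← aux β hβ0 hβ1]
      exact le_of_eq (by ring)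
    · simp [hu, hv, A, B]
  calc _ = G.transportCost σ + (G.transportCost τ + ENNReal.ofReal s * G.dist a b) := by ring
    _ ≤ _ := (add_le_add_right key _).trans key2

open Classical in
-- Whatever a plan already moves from `a` to `b` is split off. Either this covers all of `s`, or the
-- remaining plan has entry `0` at `(a, b)` and `exists_plan_of_exchange` applies.
theorem wasserstein_add_single_ge {μ ν : V → ℝ} (hμ : ∀ x, 0 ≤ μ x) (hν : ∀ x, 0 ≤ ν x) {s : ℝ}
    (hs : 0 ≤ s) {a b : V}
    (hex : ∀ u v, μ u ≠ 0 → ν v ≠ 0 → G.dist u v + G.dist a b ≤ G.dist u b + G.dist a v) :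
    G.wasserstein μ ν + ENNReal.ofReal s * G.dist a b ≤
      G.wasserstein (μ + Pi.single a s) (ν + Pi.single b s) := by
  conv_rhs => rw [wasserstein]
  refine le_iInf₂ fun π hπ => ?_
  suffices h : ∃ ρ, IsTransportPlan μ ν ρ ∧
      G.transportCost ρ + ENNReal.ofReal s * G.dist a b ≤ G.transportCost π by
    obtain ⟨ρ, h1, h2⟩ := h
    exact (add_le_add_left (wasserstein_le h1) _).trans h2
  -- `t` is the mass that `π` already moves from `a` to `b`
  set t := min s (π a b) with ht
  have ht0 : 0 ≤ t := le_min hs (hπ.nonneg a b)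
  let δ : V → V → ℝ := fun u v => if u = a then (if v = b then t else 0) else 0
  have hδ : ∀ u v, 0 ≤ δ u v := fun u v => by simp only [δ]; split_ifs <;> simp [ht0]
  have hδπ : ∀ u v, 0 ≤ (π - δ) u v := fun u v => by
    simp only [δ, Pi.sub_apply, sub_nonneg]
    split_ifs with h1 h2
    · subst h1 h2; exact min_le_right _ _
    · exact hπ.nonneg _ _
    · exact hπ.nonneg _ _
  have hplan : IsTransportPlan (μ + Pi.single a (s - t)) (ν + Pi.single b (s - t)) (π - δ) :=
    { nonneg := hδπ
      fst_marginal := fun u => by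
        by_cases h : u = a
        · subst h
          refine ((hπ.fst_marginal u).sub (hasSum_ite_eq b t)).of_eq (fun v => ?_) ?_
          · simp [δ]
          · simp; ring
        · simpa [h, δ] using hπ.fst_marginal u
      snd_marginal := fun v => by
        by_cases h : v = b
        · subst h
          refine ((hπ.snd_marginal v).sub (hasSum_ite_eq a t)).of_eq (fun u => ?_) ?_
          · simp [δ]
          · simp; ring
        · simpa [h, δ] using hπ.snd_marginal v }
  have hδc : G.transportCost δ = ENNReal.ofReal t * G.dist a b := by
    rw [transportCost, tsum_eq_single b (fun v hv => by simp [δ, hv]),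
      tsum_eq_single a (fun u hu => by simp [δ, hu])]
    simp [δ, mul_comm]
  have hcost : G.transportCost π = G.transportCost (π - δ) + ENNReal.ofReal t * G.dist a b := by
    rw [← hδc, ← G.transportCost_add hδπ hδ, sub_add_cancel]
  rcases le_or_gt s (π a b) with h | h
  · have hts : t = s := min_eq_left h
    refine ⟨π - δ, by simpa [hts] using hplan, ?_⟩
    rw [hcost, hts]
  · have hts : t = π a b := min_eq_right h.le
    obtain ⟨ρ, h1, h2⟩ := G.exists_plan_of_exchange hμ hν (s := s - t) (by linarith) (a := a)
      (b := b) (by simp) (fun u hu => by simp [hu]) (by simp) (fun u hu => by simp [hu])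
      hex hplan (by simp [δ, hts])
    refine ⟨ρ, h1, ?_⟩
    rw [hcost]
    refine le_trans (le_of_eq ?_) (add_le_add_left h2 _)
    rw [add_assoc, ← add_mul, ← ENNReal.ofReal_add (by linarith) ht0]
    simp

open Classical in
/-- Common mass need not be moved. -/
theorem Connected.wasserstein_le_add_sum_single {G : SimpleGraph V} (hG : G.Connected)
    {μ ν : V → ℝ} (hμ : ∀ x, 0 ≤ μ x) (hν : ∀ x, 0 ≤ ν x) {s : ℝ} (hs : 0 ≤ s) (F : Finset V) :
    G.wasserstein μ ν ≤
      G.wasserstein (μ + ∑ z ∈ F, Pi.single z s) (ν + ∑ z ∈ F, Pi.single z s) := by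
  have hsum : ∀ (F : Finset V) x, 0 ≤ (∑ z ∈ F, (Pi.single z s : V → ℝ)) x := fun F x => by
    rw [Finset.sum_apply]
    exact Finset.sum_nonneg fun z _ => by rw [Pi.single_apply]; split_ifs <;> simp [hs]
  induction F using Finset.induction_on with
  | empty => simp
  | insert z F hz ih =>
    refine ih.trans ?_
    rw [Finset.sum_insert hz, add_comm (Pi.single z s : V → ℝ), ← add_assoc, ← add_assoc]
    refine le_self_add.trans (G.wasserstein_add_single_ge
      (fun x => add_nonneg (hμ x) (hsum F x)) (fun x => add_nonneg (hν x) (hsum F x)) hs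
      (a := z) (b := z) fun u v _ _ => ?_)
    -- For `a = b = z` the exchange condition is the triangle inequality through `z`.
    simpa using hG.dist_triangle

end Wasserstein

/-! ### Idleness and the Lin–Lu–Yau limit -/

section Idleness

variable {V : Type*} (G : SimpleGraph V)

open Classical in
/-- The indicator function of the closed unit ball around `x`. -/
noncomputable def ballIndicator (x : V) : V → ℝ := fun z =>
  if z = x ∨ G.Adj x z then 1 else 0

theorem ballIndicator_nonneg (x z : V) : 0 ≤ G.ballIndicator x z := by
  unfold ballIndicator; split_ifs <;> norm_num

variable {G} in
theorem Connected.two_le_dist_of_not_mem_ball (hG : G.Connected) {u y : V}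
    (h : ¬(u = y ∨ G.Adj y u)) : 2 ≤ G.dist u y := by
  rw [not_or] at h
  have h0 : G.dist u y ≠ 0 := fun h' => h.1 (hG.dist_eq_zero_iff.1 h')
  have h1 : G.dist u y ≠ 1 := fun h' => h.2 (dist_eq_one_iff_adj.1 h').symm
  omega

variable [G.LocallyFinite]

open Classical in
-- For positive degree `d`, the point mass is nonnegative exactly when `p ≥ 1 / (d + 1)`, and it
-- vanishes at equality.
theorem idleMeasure_eq_smul_ballIndicator_add (p : ℝ) (x : V) :
    G.idleMeasure p x = ((1 - p) / G.degree x) • G.ballIndicator x +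
      Pi.single x (p - (1 - p) / G.degree x) := by
  funext z
  by_cases h : z = x
  · subst h; simp [idleMeasure, ballIndicator]
  · simp [idleMeasure, ballIndicator, h]

theorem idleMeasure_inv_degree_succ (x : V) :
    G.idleMeasure (1 / (G.degree x + 1)) x =
      (1 / ((G.degree x : ℝ) + 1)) • G.ballIndicator x := by
  funext z
  have h1 : (G.degree x : ℝ) + 1 ≠ 0 := by positivity
  by_cases h : z = x
  · subst h; simp [idleMeasure, ballIndicator]
  · by_cases ha : G.Adj x z
    · have h0 : (G.degree x : ℝ) ≠ 0 := by
        have := (G.degree_pos_iff_exists_adj x).2 ⟨z, ha⟩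
        positivity
      simp [idleMeasure, ballIndicator, h, ha]
      field_simp
      ring
    · simp [idleMeasure, ballIndicator, h, ha]

theorem hasSum_ballIndicator (x : V) : HasSum (G.ballIndicator x) (G.degree x + 1) := by
  classical
  have h1 := (hasSum_ite_eq x (1 : ℝ)).add
    (hasSum_sum (s := G.neighborFinset x) fun z _ => hasSum_ite_eq z (1 : ℝ))
  refine h1.of_eq (fun z => ?_) ?_
  · by_cases h : z = x
    · subst h; simp [ballIndicator]
    · simp [ballIndicator, h]
  · simp [add_comm]

theorem idleMeasure_nonneg {p : ℝ} (h0 : 0 ≤ p) (h1 : p ≤ 1) (x z : V) :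
    0 ≤ G.idleMeasure p x z := by
  unfold idleMeasure
  split_ifs
  · exact h0
  · exact div_nonneg (by linarith) (by positivity)
  · exact le_rfl

theorem finite_support_idleMeasure (p : ℝ) (x : V) :
    (Function.support (G.idleMeasure p x)).Finite := by
  refine ((Set.toFinite (G.neighborSet x)).insert x).subset fun z hz => ?_
  by_contra h
  simp only [Set.mem_insert_iff, mem_neighborSet, not_or] at h
  exact hz (by simp [idleMeasure, h.1, h.2])

theorem hasSum_idleMeasure (p : ℝ) {x : V} (hx : 0 < G.degree x) :
    HasSum (G.idleMeasure p x) 1 := by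
  classical
  have h1 := (hasSum_ite_eq x p).add
    (hasSum_sum (s := G.neighborFinset x) fun z _ => hasSum_ite_eq z ((1 - p) / G.degree x))
  refine h1.of_eq (fun z => ?_) ?_
  · by_cases h : z = x
    · subst h; simp [idleMeasure]
    · simp [idleMeasure, h]
  · have : (G.degree x : ℝ) ≠ 0 := by positivity
    simp only [Finset.sum_const, card_neighborFinset_eq_degree, nsmul_eq_mul]
    field_simp
    ring

theorem wasserstein_idleMeasure_ne_top {p : ℝ} (h0 : 0 ≤ p) (h1 : p ≤ 1) {x y : V}
    (hx : 0 < G.degree x) (hy : 0 < G.degree y) :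
    G.wasserstein (G.idleMeasure p x) (G.idleMeasure p y) ≠ ⊤ :=
  G.wasserstein_ne_top (G.idleMeasure_nonneg h0 h1 x) (G.idleMeasure_nonneg h0 h1 y)
    (G.hasSum_idleMeasure p hx) (G.hasSum_idleMeasure p hy)
    (G.finite_support_idleMeasure p x) (G.finite_support_idleMeasure p y)

variable {G}

open Classical in
/-- The mass in the intersection of the two balls can stay in place, and the remaining excess mass
at `x` can be moved to `y` directly. -/
theorem Connected.wasserstein_ball_add_single (hG : G.Connected) {x y : V} (hxy : G.Adj x y)
    {r s : ℝ} (hr : 0 ≤ r) (hs : 0 ≤ s) :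
    G.wasserstein (r • G.ballIndicator x + Pi.single x s)
        (r • G.ballIndicator y + Pi.single y s) =
      G.wasserstein (r • G.ballIndicator x) (r • G.ballIndicator y) + ENNReal.ofReal s := by
  have hd : G.dist x y = 1 := dist_eq_one_iff_adj.2 hxy
  refine le_antisymm ?_ ?_
  · refine (G.wasserstein_add_le _ _ _ _).trans (add_le_add_right ?_ _)
    simpa [hd] using G.wasserstein_single_le x y hs
  -- `D x y` is the part of the ball mass at `x` lying outside the ball at `y`, and `σ` below is the
  -- common part. The common part is removed first because the exchange condition is only checked on
  -- the differences.
  let D : V → V → V → ℝ := fun x y z =>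
    if (z = x ∨ G.Adj x z) ∧ ¬(z = y ∨ G.Adj y z) then r else 0
  have hD : ∀ x y z, 0 ≤ D x y z := fun x y z => by
    simp only [D]; split_ifs <;> simp [hr]
  have hsingle : ∀ x z : V, 0 ≤ (Pi.single x s : V → ℝ) z := fun x z => by
    rw [Pi.single_apply]; split_ifs <;> simp [hs]
  let F : Finset V := (insert x (G.neighborFinset x)).filter fun z => z = y ∨ G.Adj y z
  set σ : V → ℝ := ∑ z ∈ F, Pi.single z r with hσ
  have hσ' : ∀ z, σ z = if (z = x ∨ G.Adj x z) ∧ (z = y ∨ G.Adj y z) then r else 0 := by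
    intro z
    rw [hσ, Finset.sum_apply]
    simp only [Pi.single_apply, Finset.sum_ite_eq]
    simp [F]
  have hσ0 : ∀ z, 0 ≤ σ z := fun z => by rw [hσ' z]; split_ifs <;> simp [hr]
  have hx : r • G.ballIndicator x = D x y + σ := by
    funext z
    simp only [Pi.smul_apply, Pi.add_apply, hσ', D, ballIndicator, smul_eq_mul]
    by_cases h1 : z = x ∨ G.Adj x z <;> by_cases h2 : z = y ∨ G.Adj y z <;> simp [h1, h2]
  have hy : r • G.ballIndicator y = D y x + σ := by
    funext z
    simp only [Pi.smul_apply, Pi.add_apply, hσ', D, ballIndicator, smul_eq_mul]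
    by_cases h1 : z = x ∨ G.Adj x z <;> by_cases h2 : z = y ∨ G.Adj y z <;> simp [h1, h2]
  calc G.wasserstein (r • G.ballIndicator x) (r • G.ballIndicator y) + ENNReal.ofReal s
      ≤ G.wasserstein (D x y) (D y x) + ENNReal.ofReal s * G.dist x y := by
        rw [hx, hy, hd]
        refine add_le_add ((G.wasserstein_add_le _ _ _ _).trans ?_) (by simp)
        simp [G.wasserstein_self hσ0]
    _ ≤ G.wasserstein (D x y + Pi.single x s) (D y x + Pi.single y s) := by
        -- With `u` only in the ball at `x` and `v` only in the ball at `y`, `d(u, v) + d(x, y) ≤ 3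
        -- + 1`, while `d(u, y)` and `d(x, v)` are both at least `2`.
        refine G.wasserstein_add_single_ge (hD x y) (hD y x) hs fun u v hu hv => ?_
        have hu' : (u = x ∨ G.Adj x u) ∧ ¬(u = y ∨ G.Adj y u) := by
          by_contra h; exact hu (if_neg h)
        have hv' : (v = y ∨ G.Adj y v) ∧ ¬(v = x ∨ G.Adj x v) := by
          by_contra h; exact hv (if_neg h)
        have a1 := hG.two_le_dist_of_not_mem_ball hu'.2
        have a2 := hG.two_le_dist_of_not_mem_ball hv'.2
        rw [dist_comm] at a2
        have ball : ∀ {a b : V}, (b = a ∨ G.Adj a b) → G.dist a b ≤ 1 := by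
          rintro a b (rfl | h)
          · simp
          · exact (dist_eq_one_iff_adj.2 h).le
        have b1 := ball hu'.1
        have b2 := ball hv'.1
        have c1 : G.dist u v ≤ G.dist u x + G.dist x v := hG.dist_triangle
        have c2 : G.dist x v ≤ G.dist x y + G.dist y v := hG.dist_triangle
        rw [dist_comm (u := x) (v := u)] at b1
        omega
    _ ≤ _ := hG.wasserstein_le_add_sum_single (fun z => add_nonneg (hD x y z) (hsingle x z))
        (fun z => add_nonneg (hD y x z) (hsingle y z)) hr F
    _ = _ := by
        rw [hx, hy, add_right_comm (D x y) σ, add_right_comm (D y x) σ]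
        rfl

theorem Connected.ollivierCurvature_eq_one_sub (hG : G.Connected) {d : ℕ} {x y : V}
    (hx : G.degree x = d) (hy : G.degree y = d) (hxy : G.Adj x y) {p : ℝ}
    (hp : 1 / ((d : ℝ) + 1) ≤ p) (hp1 : p < 1) :
    G.ollivierCurvature p x y = 1 - (p - (1 - p) / d) -
      (1 - p) / d * (G.wasserstein (G.ballIndicator x) (G.ballIndicator y)).toReal := by
  have hd : 0 < d := hx ▸ (G.degree_pos_iff_exists_adj x).2 ⟨y, hxy⟩
  have hd' : (0 : ℝ) < d := by positivity
  have hp0 : 0 ≤ p := le_trans (by positivity) hp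
  have hr : 0 < (1 - p) / d := div_pos (by linarith) hd'
  have hs : 0 ≤ p - (1 - p) / d := by
    rw [div_le_iff₀ (by positivity)] at hp
    rw [sub_nonneg, div_le_iff₀ hd']
    linarith
  have hW : G.wasserstein (G.idleMeasure p x) (G.idleMeasure p y) =
      ENNReal.ofReal ((1 - p) / d) * G.wasserstein (G.ballIndicator x) (G.ballIndicator y) +
        ENNReal.ofReal (p - (1 - p) / d) := by
    rw [idleMeasure_eq_smul_ballIndicator_add, idleMeasure_eq_smul_ballIndicator_add, hx, hy,
      hG.wasserstein_ball_add_single hxy hr.le hs, G.wasserstein_smul _ _ hr]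
  have hfin := G.wasserstein_idleMeasure_ne_top hp0 hp1.le (hx ▸ hd) (hy ▸ hd)
  rw [hW] at hfin
  rw [ollivierCurvature, hW, ENNReal.toReal_add (ENNReal.add_ne_top.1 hfin).1
    ENNReal.ofReal_ne_top, ENNReal.toReal_mul, ENNReal.toReal_ofReal hr.le,
    ENNReal.toReal_ofReal hs]
  ring

/-- On `[1 / (d + 1), 1)` the curvature `κ_p` is a linear function of `1 - p`. -/
theorem Connected.ollivierCurvature_eq_mul (hG : G.Connected) {d : ℕ} {x y : V}
    (hx : G.degree x = d) (hy : G.degree y = d) (hxy : G.Adj x y) {p : ℝ}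
    (hp : 1 / ((d : ℝ) + 1) ≤ p) (hp1 : p < 1) :
    G.ollivierCurvature p x y =
      (((d : ℝ) + 1) / d * G.ollivierCurvature (1 / (d + 1)) x y) * (1 - p) := by
  have hd : 0 < d := hx ▸ (G.degree_pos_iff_exists_adj x).2 ⟨y, hxy⟩
  have hd' : (0 : ℝ) < d := by positivity
  have h1 : 1 / ((d : ℝ) + 1) < 1 := by rw [div_lt_one (by positivity)]; linarith
  rw [hG.ollivierCurvature_eq_one_sub hx hy hxy hp hp1,
    hG.ollivierCurvature_eq_one_sub hx hy hxy le_rfl h1]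
  field_simp
  ring

/-- The quotient is constant on `(1 / (d + 1), 1)`. -/
theorem Connected.tendsto_ollivierCurvature_div (hG : G.Connected) {d : ℕ} {x y : V}
    (hx : G.degree x = d) (hy : G.degree y = d) (hxy : G.Adj x y) :
    Tendsto (fun p => G.ollivierCurvature p x y / (1 - p)) (𝓝[<] (1 : ℝ))
      (𝓝 (((d : ℝ) + 1) / d * G.ollivierCurvature (1 / (d + 1)) x y)) := by
  have hd : 0 < d := hx ▸ (G.degree_pos_iff_exists_adj x).2 ⟨y, hxy⟩
  have hd' : (0 : ℝ) < d := by positivity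
  have h1 : 1 / ((d : ℝ) + 1) < 1 := by rw [div_lt_one (by positivity)]; linarith
  refine tendsto_const_nhds.congr' ?_
  filter_upwards [Ioo_mem_nhdsLT h1] with p hp
  rw [hG.ollivierCurvature_eq_mul hx hy hxy hp.1.le hp.2,
    mul_div_cancel_right₀ _ (by linarith [hp.2])]

theorem Connected.llyCurvature_eq (hG : G.Connected) {d : ℕ} {x y : V}
    (hx : G.degree x = d) (hy : G.degree y = d) (hxy : G.Adj x y) :
    G.llyCurvature x y = ((d : ℝ) + 1) / d * G.ollivierCurvature (1 / (d + 1)) x y :=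
  (hG.tendsto_ollivierCurvature_div hx hy hxy).limUnder_eq

theorem Connected.llyCurvatureExists (hG : G.Connected) {d : ℕ} {x y : V}
    (hx : G.degree x = d) (hy : G.degree y = d) (hxy : G.Adj x y) :
    G.LLYCurvatureExists x y := by
  rw [LLYCurvatureExists, hG.llyCurvature_eq hx hy hxy]
  exact hG.tendsto_ollivierCurvature_div hx hy hxy

end Idleness

/-! ### Invariance under graph isomorphisms -/

section Iso

variable {V V' : Type*} {G : SimpleGraph V} {G' : SimpleGraph V'}

theorem Reachable.dist_map_le {u v : V} (h : G.Reachable u v) (f : G →g G') :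
    G'.dist (f u) (f v) ≤ G.dist u v := by
  obtain ⟨w, hw⟩ := h.exists_walk_length_eq_dist
  rw [← hw, ← w.length_map f]
  exact dist_le _

theorem Connected.wasserstein_comp_le (hG' : G'.Connected) (e : G ≃g G') (μ ν : V' → ℝ) :
    G.wasserstein (μ ∘ e) (ν ∘ e) ≤ G'.wasserstein μ ν := by
  conv_rhs => rw [wasserstein]
  refine le_iInf₂ fun π hπ => ?_
  have hp : IsTransportPlan (μ ∘ e) (ν ∘ e) (fun u v => π (e u) (e v)) :=
    { nonneg := fun u v => hπ.nonneg _ _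
      fst_marginal := fun u => (e.toEquiv.hasSum_iff).2 (hπ.fst_marginal (e u))
      snd_marginal := fun v =>
        (e.toEquiv.hasSum_iff (f := fun u => π u (e v))).2 (hπ.snd_marginal (e v)) }
  refine (wasserstein_le hp).trans ?_
  rw [transportCost, transportCost, ← e.toEquiv.tsum_eq]
  refine ENNReal.tsum_le_tsum fun v => ?_
  rw [← e.toEquiv.tsum_eq]
  refine ENNReal.tsum_le_tsum fun u => ?_
  have := (hG'.preconnected (e u) (e v)).dist_map_le e.symm.toHom
  simp only [RelEmbedding.coe_toRelHom, RelIso.coe_toRelEmbedding, RelIso.symm_apply_apply] at this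
  refine mul_le_mul_left ?_ _
  exact_mod_cast this

theorem Connected.wasserstein_comp (hG : G.Connected) (hG' : G'.Connected) (e : G ≃g G')
    (μ ν : V' → ℝ) : G.wasserstein (μ ∘ e) (ν ∘ e) = G'.wasserstein μ ν := by
  refine (hG'.wasserstein_comp_le e μ ν).antisymm ?_
  have h := hG.wasserstein_comp_le e.symm (μ ∘ e) (ν ∘ e)
  have h' : ∀ f : V' → ℝ, (f ∘ e) ∘ e.symm = f := fun f => by funext z; simp
  rwa [h', h'] at h

variable [G.LocallyFinite] [G'.LocallyFinite]

theorem Iso.degree_apply (e : G ≃g G') (x : V) : G'.degree (e x) = G.degree x := by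
  rw [← card_neighborSet_eq_degree, ← card_neighborSet_eq_degree]
  exact (Fintype.card_congr (e.mapNeighborSet x)).symm

theorem idleMeasure_comp_iso (e : G ≃g G') (p : ℝ) (x : V) :
    G'.idleMeasure p (e x) ∘ e = G.idleMeasure p x := by
  funext z
  have h1 : e z = e x ↔ z = x := e.injective.eq_iff
  have h2 : G'.Adj (e x) (e z) ↔ G.Adj x z := e.map_adj_iff
  by_cases hz : z = x <;> by_cases ha : G.Adj x z <;>
    simp [idleMeasure, e.degree_apply, h1, h2, hz, ha]

theorem Connected.ollivierCurvature_iso (hG : G.Connected) (hG' : G'.Connected) (e : G ≃g G')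
    (p : ℝ) (x y : V) : G'.ollivierCurvature p (e x) (e y) = G.ollivierCurvature p x y := by
  rw [ollivierCurvature, ollivierCurvature, ← hG.wasserstein_comp hG' e, idleMeasure_comp_iso,
    idleMeasure_comp_iso]

theorem Connected.llyCurvature_iso (hG : G.Connected) (hG' : G'.Connected) (e : G ≃g G')
    (x y : V) : G'.llyCurvature (e x) (e y) = G.llyCurvature x y := by
  simp only [llyCurvature, hG.ollivierCurvature_iso hG' e]

end Iso

/-! ### Strong products -/

section StrongProduct

variable {V W : Type*} (G : SimpleGraph V) (H : SimpleGraph W)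

theorem strongProd_adj {a b : V × W} : (G.strongProd H).Adj a b ↔
    (G.Adj a.1 b.1 ∧ a.2 = b.2) ∨ (a.1 = b.1 ∧ H.Adj a.2 b.2) ∨
      (G.Adj a.1 b.1 ∧ H.Adj a.2 b.2) :=
  Iff.rfl

/-- The closed neighbourhoods of a strong product are the products of closed neighbourhoods. -/
theorem eq_or_strongProd_adj {a b : V × W} : (b = a ∨ (G.strongProd H).Adj a b) ↔
    (b.1 = a.1 ∨ G.Adj a.1 b.1) ∧ (b.2 = a.2 ∨ H.Adj a.2 b.2) := by
  rw [strongProd_adj, Prod.ext_iff, eq_comm (a := a.1), eq_comm (a := a.2)]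
  tauto

/-- The isomorphism swapping the factors of a strong product. -/
def strongProdSwap : G.strongProd H ≃g H.strongProd G where
  toEquiv := Equiv.prodComm V W
  map_rel_iff' := by
    intro a b
    simp only [strongProd_adj, Equiv.prodComm_apply, Prod.fst_swap, Prod.snd_swap]
    tauto

/-- The inclusion of a horizontal layer. -/
def strongProdLeft (w : W) : G →g G.strongProd H where
  toFun u := (u, w)
  map_rel' h := Or.inl ⟨h, rfl⟩

variable {G H} in
theorem Connected.strongProd (hG : G.Connected) (hH : H.Connected) :
    (G.strongProd H).Connected := by
  refine (hG.boxProd hH).mono fun a b h => ?_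
  rw [boxProd_adj] at h
  rw [strongProd_adj]
  tauto

variable {G} in
-- A plan on `G` is copied into each layer `w` with weight `η w`. Including a layer is a graph
-- homomorphism, so it does not increase distances.
theorem Connected.wasserstein_strongProd_le (hG : G.Connected) (μ ν : V → ℝ) {η : W → ℝ}
    (hη : ∀ w, 0 ≤ η w) {m : ℝ} (hm : HasSum η m) :
    (G.strongProd H).wasserstein (fun a => μ a.1 * η a.2) (fun a => ν a.1 * η a.2) ≤
      ENNReal.ofReal m * G.wasserstein μ ν := by
  classical
  -- The case `m = 0` is separate because moving the factor inside the infimum requires it to be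
  -- nonzero.
  rcases (hm.nonneg hη).eq_or_lt with rfl | hm0
  · have : η = 0 := (hasSum_zero_iff_of_nonneg hη).1 hm
    subst this
    simpa using (wasserstein_self _ (fun _ => le_rfl)).le
  have h0 : ENNReal.ofReal m ≠ 0 := by simpa using hm0
  conv_rhs => rw [wasserstein, ENNReal.mul_iInf_of_ne h0 ENNReal.ofReal_ne_top]
  refine le_iInf fun π => ?_
  rw [ENNReal.mul_iInf_of_ne h0 ENNReal.ofReal_ne_top]
  refine le_iInf fun hπ => ?_
  have hp : IsTransportPlan (fun a : V × W => μ a.1 * η a.2) (fun a => ν a.1 * η a.2)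
      (fun a b => if b.2 = a.2 then π a.1 b.1 * η a.2 else 0) :=
    { nonneg := fun a b => by
        split_ifs
        · exact mul_nonneg (hπ.nonneg _ _) (hη _)
        · exact le_rfl
      fst_marginal := fun a => by
        refine (Function.Injective.hasSum_iff (g := fun v : V => (v, a.2))
          (fun _ _ h => congrArg Prod.fst h) ?_).1 ?_
        · rintro ⟨v, w⟩ h
          refine if_neg fun hw => h ⟨v, ?_⟩
          simp_all
        · simpa [Function.comp_def] using (hπ.fst_marginal a.1).mul_right (η a.2)
      snd_marginal := fun b => by
        refine (Function.Injective.hasSum_iff (g := fun v : V => (v, b.2))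
          (fun _ _ h => congrArg Prod.fst h) ?_).1 ?_
        · rintro ⟨v, w⟩ h
          refine if_neg fun hw => h ⟨v, ?_⟩
          simp_all
        · simpa [Function.comp_def] using (hπ.snd_marginal b.1).mul_right (η b.2) }
  refine (wasserstein_le hp).trans ?_
  have hm' : ENNReal.ofReal m = ∑' w, ENNReal.ofReal (η w) := by
    rw [← hm.tsum_eq, ENNReal.ofReal_tsum_of_nonneg hη hm.summable]
  rw [transportCost, ENNReal.tsum_prod', ENNReal.tsum_comm, hm', ← ENNReal.tsum_mul_right]
  refine ENNReal.tsum_le_tsum fun w => ?_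
  rw [transportCost, ← ENNReal.tsum_mul_left]
  refine ENNReal.tsum_le_tsum fun v => ?_
  rw [ENNReal.tsum_prod', ← ENNReal.tsum_mul_left]
  refine ENNReal.tsum_le_tsum fun u => ?_
  rw [tsum_eq_single w (fun w' hw' => by simp [Ne.symm hw'])]
  have hd := (hG.preconnected u v).dist_map_le (G.strongProdLeft H w)
  rw [if_pos rfl, ENNReal.ofReal_mul (hπ.nonneg u v)]
  calc _ ≤ (G.dist u v : ENNReal) * (ENNReal.ofReal (π u v) * ENNReal.ofReal (η w)) :=
        mul_le_mul_left (by exact_mod_cast hd) _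
    _ = _ := by ring

theorem ballIndicator_strongProd (x : V) (y : W) :
    (G.strongProd H).ballIndicator (x, y) =
      fun a => G.ballIndicator x a.1 * H.ballIndicator y a.2 := by
  funext a
  have h := eq_or_strongProd_adj G H (a := (x, y)) (b := a)
  by_cases h1 : a.1 = x ∨ G.Adj x a.1 <;> by_cases h2 : a.2 = y ∨ H.Adj y a.2 <;>
    simp [ballIndicator, h, h1, h2]

variable [G.LocallyFinite] [H.LocallyFinite]

theorem degree_strongProd (a : V × W) :
    (G.strongProd H).degree a = G.degree a.1 + H.degree a.2 + G.degree a.1 * H.degree a.2 := by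
  classical
  have h : insert a ((G.strongProd H).neighborFinset a) =
      insert a.1 (G.neighborFinset a.1) ×ˢ insert a.2 (H.neighborFinset a.2) := by
    ext b
    simpa using eq_or_strongProd_adj G H
  have h' := congrArg Finset.card h
  rw [Finset.card_product, Finset.card_insert_of_notMem (by simp),
    Finset.card_insert_of_notMem (by simp), Finset.card_insert_of_notMem (by simp)] at h'
  simp only [card_neighborFinset_eq_degree] at h'
  linarith

variable {G H} in
theorem IsRegularOfDegree.strongProd {dG dH : ℕ} (hG : G.IsRegularOfDegree dG)
    (hH : H.IsRegularOfDegree dH) :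
    (G.strongProd H).IsRegularOfDegree (dG + dH + dG * dH) := fun a => by
  rw [degree_strongProd, hG, hH]

open Classical in
-- The first summand carries the horizontal and diagonal neighbours, the second the vertical ones.
-- Subtracting the point mass at `y` keeps `(x, y)` itself empty.
theorem idleMeasure_zero_strongProd (x : V) (y : W) (hx : 0 < G.degree x) :
    (G.strongProd H).idleMeasure 0 (x, y) =
      (fun a => G.idleMeasure 0 x a.1 *
        ((G.degree x / (G.strongProd H).degree (x, y) : ℝ) * H.ballIndicator y a.2)) +
      (fun a => (Pi.single x 1 : V → ℝ) a.1 *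
        ((1 / (G.strongProd H).degree (x, y) : ℝ) *
          (H.ballIndicator y a.2 - (Pi.single y 1 : W → ℝ) a.2))) := by
  funext ⟨u, w⟩
  have hx' : (G.degree x : ℝ) ≠ 0 := by positivity
  by_cases h1 : u = x <;> by_cases h2 : w = y <;> by_cases h3 : G.Adj x u <;>
    by_cases h4 : H.Adj y w <;>
    simp_all [idleMeasure, ballIndicator, strongProd_adj, eq_comm] <;> field_simp

variable {G H} in
theorem Connected.ollivierCurvature_zero_strongProd_ge (hG : G.Connected) {dG dH : ℕ}
    (hdG : G.IsRegularOfDegree dG) (hdH : H.IsRegularOfDegree dH) {x₁ x₂ : V} (y : W)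
    (hx : G.Adj x₁ x₂) :
    ((dG : ℝ) * (dH + 1)) / (dG + dH + dG * dH) * G.ollivierCurvature 0 x₁ x₂ ≤
      (G.strongProd H).ollivierCurvature 0 (x₁, y) (x₂, y) := by
  classical
  have hd : 0 < dG := hdG x₁ ▸ (G.degree_pos_iff_exists_adj x₁).2 ⟨x₂, hx⟩
  have hd' : (0 : ℝ) < dG := by positivity
  have hD : ∀ a, ((G.strongProd H).degree a : ℝ) = dG + dH + dG * dH := fun a => by
    rw [hdG.strongProd hdH a]; push_cast; ring
  set D : ℝ := dG + dH + dG * dH with hDdef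
  have hD0 : 0 < D := by positivity
  have hball : HasSum (H.ballIndicator y) (dH + 1) := by
    simpa [hdH y] using H.hasSum_ballIndicator y
  have hη₁ := hball.mul_left (dG / D)
  have hη₂ := (hball.sub (hasSum_pi_single y (1 : ℝ))).mul_left (1 / D)
  have hpos : ∀ w, 0 ≤ H.ballIndicator y w - (Pi.single y 1 : W → ℝ) w := fun w => by
    by_cases h : w = y
    · subst h; simp [ballIndicator]
    · simpa [h] using H.ballIndicator_nonneg y w
  have hfin := G.wasserstein_idleMeasure_ne_top le_rfl zero_le_one (x := x₁) (y := x₂)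
    (by rw [hdG]; exact hd) (by rw [hdG]; exact hd)
  have hW : (G.strongProd H).wasserstein ((G.strongProd H).idleMeasure 0 (x₁, y))
      ((G.strongProd H).idleMeasure 0 (x₂, y)) ≤
      ENNReal.ofReal (dG / D * (dH + 1)) *
        G.wasserstein (G.idleMeasure 0 x₁) (G.idleMeasure 0 x₂) +
      ENNReal.ofReal (1 / D * (dH + 1 - 1)) := by
    rw [idleMeasure_zero_strongProd _ _ _ _ (by rw [hdG]; exact hd),
      idleMeasure_zero_strongProd _ _ _ _ (by rw [hdG]; exact hd), hD, hD, hdG, hdG]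
    refine (wasserstein_add_le _ _ _ _ _).trans (add_le_add
      (hG.wasserstein_strongProd_le H _ _
        (fun w => mul_nonneg (by positivity) (H.ballIndicator_nonneg y w)) hη₁)
      ((hG.wasserstein_strongProd_le H _ _
        (fun w => mul_nonneg (by positivity) (hpos w)) hη₂).trans ?_))
    refine (mul_le_mul_right (G.wasserstein_single_le x₁ x₂ zero_le_one) _).trans ?_
    simp [dist_eq_one_iff_adj.2 hx]
  have hc : 0 ≤ dG / D * ((dH : ℝ) + 1) := by positivity
  have hb : 0 ≤ 1 / D * ((dH : ℝ) + 1 - 1) := by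
    rw [add_sub_cancel_right]; positivity
  have hreal := ENNReal.toReal_mono (by finiteness) hW
  rw [ENNReal.toReal_add (by finiteness) (by finiteness), ENNReal.toReal_mul,
    ENNReal.toReal_ofReal hc, ENNReal.toReal_ofReal hb] at hreal
  rw [ollivierCurvature, ollivierCurvature]
  -- By `e2` the cost `dH / D` of the vertical part is `1` minus the coefficient of `W₁`, so the
  -- bound on `W₁` becomes one on `1 - W₁` with no constant left over.
  have e1 : (dG : ℝ) * (dH + 1) / D = dG / D * (dH + 1) := by ring
  have e2 : 1 / D * ((dH : ℝ) + 1 - 1) = 1 - dG / D * (dH + 1) := by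
    field_simp
    rw [hDdef]; ring
  rw [e1]
  linarith

variable {G H} in
theorem Connected.llyCurvature_strongProd_ge (hG : G.Connected) (hH : H.Connected) {dG dH : ℕ}
    (hdG : G.IsRegularOfDegree dG) (hdH : H.IsRegularOfDegree dH) {x₁ x₂ : V} (y : W)
    (hx : G.Adj x₁ x₂) :
    ((dG : ℝ) * (dH + 1)) / (dG + dH + dG * dH) * G.llyCurvature x₁ x₂ ≤
      (G.strongProd H).llyCurvature (x₁, y) (x₂, y) := by
  have hd : 0 < dG := hdG x₁ ▸ (G.degree_pos_iff_exists_adj x₁).2 ⟨x₂, hx⟩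
  have hd' : (0 : ℝ) < dG := by positivity
  have hK := hdG.strongProd hdH
  rw [hG.llyCurvature_eq (hdG x₁) (hdG x₂) hx, (hG.strongProd hH).llyCurvature_eq
    (hK (x₁, y)) (hK (x₂, y)) (Or.inl ⟨hx, rfl⟩)]
  -- At these two idleness values all measures are uniform on closed balls, and the vertical factor
  -- has mass `1`, so the curvatures compare without a constant.
  have key : G.ollivierCurvature (1 / (dG + 1)) x₁ x₂ ≤ (G.strongProd H).ollivierCurvature
      (1 / ((dG + dH + dG * dH : ℕ) + 1)) (x₁, y) (x₂, y) := by
    have hp1 : 1 / ((dG : ℝ) + 1) ≤ 1 := by rw [div_le_one (by positivity)]; linarith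
    have hfin := G.wasserstein_idleMeasure_ne_top (p := 1 / ((dG : ℝ) + 1)) (by positivity) hp1
      (x := x₁) (y := x₂) (by rw [hdG]; exact hd) (by rw [hdG]; exact hd)
    have hη : HasSum (fun w => 1 / ((dH : ℝ) + 1) * H.ballIndicator y w) 1 := by
      have h := (H.hasSum_ballIndicator y).mul_left (1 / ((dH : ℝ) + 1))
      rw [hdH y] at h
      exact h.of_eq (fun _ => rfl) (by field_simp)
    have hprod : ∀ x, (G.strongProd H).idleMeasure (1 / ((dG + dH + dG * dH : ℕ) + 1)) (x, y) =
        fun a => G.idleMeasure (1 / (dG + 1)) x a.1 *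
          (1 / ((dH : ℝ) + 1) * H.ballIndicator y a.2) := fun x => by
      have h1 := (G.strongProd H).idleMeasure_inv_degree_succ (x, y)
      have h2 := G.idleMeasure_inv_degree_succ x
      rw [hK (x, y), ballIndicator_strongProd] at h1
      rw [hdG x] at h2
      rw [h1, h2]
      funext a
      simp only [Pi.smul_apply, smul_eq_mul]
      have : ((dG + dH + dG * dH : ℕ) : ℝ) + 1 = (dG + 1) * (dH + 1) := by push_cast; ring
      rw [this]
      field_simp
    have hW := hG.wasserstein_strongProd_le H (G.idleMeasure (1 / (dG + 1)) x₁)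
      (G.idleMeasure (1 / (dG + 1)) x₂)
      (fun w => mul_nonneg (by positivity) (H.ballIndicator_nonneg y w)) hη
    rw [← hprod, ← hprod, ENNReal.ofReal_one, one_mul] at hW
    exact sub_le_sub_left (ENNReal.toReal_mono hfin hW) 1
  push_cast at key ⊢
  -- The constants agree: `dG (dH + 1) / D * ((dG + 1) / dG) = (D + 1) / D` with `D = dG + dH + dG *
  -- dH`.
  refine le_trans (le_of_eq ?_) (mul_le_mul_of_nonneg_left key (by positivity))
  field_simp
  ring

end StrongProduct

end SimpleGraph

theorem theorem5p3 {V W : Type*} (G : SimpleGraph V) (H : SimpleGraph W)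
    [G.LocallyFinite] [H.LocallyFinite] (hG : G.Connected) (hH : H.Connected)
    (dG dH : ℕ) (hdG : G.IsRegularOfDegree dG) (hdH : H.IsRegularOfDegree dH) :
    (G.strongProd H).IsRegularOfDegree (dG + dH + dG * dH) ∧
    -- horizontal edges
    (∀ (x₁ x₂ : V) (y₁ : W), G.Adj x₁ x₂ →
      (G.strongProd H).ollivierCurvature 0 (x₁, y₁) (x₂, y₁) ≥
        ((dG : ℝ) * ((dH : ℝ) + 1)) / ((dG : ℝ) + (dH : ℝ) + (dG : ℝ) * (dH : ℝ)) *
          G.ollivierCurvature 0 x₁ x₂ ∧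
      G.LLYCurvatureExists x₁ x₂ ∧
      (G.strongProd H).LLYCurvatureExists (x₁, y₁) (x₂, y₁) ∧
      (G.strongProd H).llyCurvature (x₁, y₁) (x₂, y₁) ≥
        ((dG : ℝ) * ((dH : ℝ) + 1)) / ((dG : ℝ) + (dH : ℝ) + (dG : ℝ) * (dH : ℝ)) *
          G.llyCurvature x₁ x₂) ∧
    -- vertical edges
    (∀ (x₁ : V) (y₁ y₂ : W), H.Adj y₁ y₂ →
      (G.strongProd H).ollivierCurvature 0 (x₁, y₁) (x₁, y₂) ≥
        ((dH : ℝ) * ((dG : ℝ) + 1)) / ((dG : ℝ) + (dH : ℝ) + (dG : ℝ) * (dH : ℝ)) *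
          H.ollivierCurvature 0 y₁ y₂ ∧
      H.LLYCurvatureExists y₁ y₂ ∧
      (G.strongProd H).LLYCurvatureExists (x₁, y₁) (x₁, y₂) ∧
      (G.strongProd H).llyCurvature (x₁, y₁) (x₁, y₂) ≥
        ((dH : ℝ) * ((dG : ℝ) + 1)) / ((dG : ℝ) + (dH : ℝ) + (dG : ℝ) * (dH : ℝ)) *
          H.llyCurvature y₁ y₂) := by
  have hK := hdG.strongProd hdH
  have hKc := hG.strongProd hH
  refine ⟨hK, fun x₁ x₂ y₁ hx => ⟨hG.ollivierCurvature_zero_strongProd_ge hdG hdH y₁ hx,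
    hG.llyCurvatureExists (hdG _) (hdG _) hx,
    hKc.llyCurvatureExists (hK _) (hK _) (Or.inl ⟨hx, rfl⟩),
    hG.llyCurvature_strongProd_ge hH hdG hdH y₁ hx⟩, fun x₁ y₁ y₂ hy => ?_⟩
  have hD : (dG : ℝ) + dH + dG * dH = dH + dG + dH * dG := by ring
  rw [hD]
  refine ⟨?_, hH.llyCurvatureExists (hdH _) (hdH _) hy,
    hKc.llyCurvatureExists (hK _) (hK _) (Or.inr (Or.inl ⟨rfl, hy⟩)), ?_⟩
  · have h := hH.ollivierCurvature_zero_strongProd_ge hdH hdG x₁ hy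
    rwa [← (hH.strongProd hG).ollivierCurvature_iso hKc (H.strongProdSwap G)] at h
  · have h := hH.llyCurvature_strongProd_ge hG hdH hdG x₁ hy
    rwa [← (hH.strongProd hG).llyCurvature_iso hKc (H.strongProdSwap G)] at h
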